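/- Let $\phi\in L^2(\mathbf R)$ with $\|\phi\|_2=1$. For $(\tau,\sigma)\in\mathbf R^2$ put $\rho(\tau,\sigma)f(t)=e^{\pi i\tau\sigma}e^{2\pi i\sigma t}f(t+\tau)$, and let $\mathcal S_\phi f(\tau,\sigma)=\langle f,\rho(\tau,\sigma)\phi\rangle=\int f(t)\,\overline{\rho(\tau,\sigma)\phi(t)}\,dt$ be the Gabor transform of $f\in L^2(\mathbf R)$. For a bounded measurable set $\Omega\subset\mathbf R^2$ let $\mathcal C_\Omega$ be the bounded operator on $L^2(\mathbf R)$ defined by $$\langle \mathcal C_\Omega f,g\rangle=\iint_\Omega \mathcal S_\phi f(\tau,\sigma)\,\overline{\mathcal S_\phi g(\tau,\sigma)}\,d\tau\,d\sigma\qquad(f,g\in L^2(\mathbf R)).$$ Let $\Omega\subset\mathbf R^2$ be a bounded measurable set of positive measure, and for $r>0$ let $\Omega_r=\{(r\tau,r\sigma):(\tau,\sigma)\in\Omega\}$. Then for every $r>0$ the operator $\mathcal C_{\Omega_r}$ has a decreasing sequence of eigenvalues $\lambda_1(\Omega_r)\ge\lambda_2(\Omega_r)\ge\cdots\ge 0$,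 with an orthonormal sequence of eigenfunctions $\psi_1,\psi_2,\dots$, $\mathcal C_{\Omega_r}\psi_k=\lambda_k(\Omega_r)\psi_k$, such that $\mathcal C_{\Omega_r}$ vanishes on the orthogonal complement of the $\psi_k$. For any such eigenvalue sequences, $\sum_k|\lambda_k(\Omega_r)|^2<\infty$ for every $r>0$, and $$\frac{\sum_k|\lambda_k(\Omega_r)|^2}{\mathrm{area}(\Omega_r)}\to 1\qquad\text{as } r\to\infty .$$ -/

import Mathlib

open MeasureTheory Filter Topology

noncomputable section

/-- The Hilbert space `L²(ℝ)` of square integrable complex functions. -/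
abbrev L2R : Type := Lp ℂ 2 (volume : Measure ℝ)

/-- The time-frequency shift
`ρ(τ,σ) f (t) = exp(π i τ σ) exp(2 π i σ t) f(t + τ)`, on functions. -/
def timeFreqShift (τ σ : ℝ) (f : ℝ → ℂ) (t : ℝ) : ℂ :=
  Complex.exp (Real.pi * Complex.I * τ * σ) * Complex.exp (2 * Real.pi * Complex.I * σ * t)
    * f (t + τ)

/-- The Gabor transform `S_φ f (τ,σ) = ∫ f(t) conj(ρ(τ,σ) φ (t)) dt`; it does not depend on
the representatives of `f` and `φ`. -/
def gaborTransform (φ f : L2R) (z : ℝ × ℝ) : ℂ :=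
  ∫ t : ℝ, f t * (starRingEnd ℂ) (timeFreqShift z.1 z.2 φ t)

/-- The energy form
`E_Ω(f,g) = ∬_Ω ⟨f, ρ(τ,σ)φ⟩ ⟨ρ(τ,σ)φ, g⟩ dτ dσ = ∬_Ω S_φ f · conj(S_φ g) dτ dσ`. -/
def energyForm (φ : L2R) (Ω : Set (ℝ × ℝ)) (f g : L2R) : ℂ :=
  ∫ z in Ω, gaborTransform φ f z * (starRingEnd ℂ) (gaborTransform φ g z)

/-- The concentration operator `C_Ω` : the bounded operator on `L²(ℝ)` with
`E_Ω(f,g) = ⟨C_Ω f, g⟩` for all `f, g`. (The inner product of Mathlib is linear in the second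
variable; `⟨x, y⟩`, linear in `x`, is `inner ℂ y x`.) Uniqueness is clear; existence for sets
of finite area is part of `inner_concentrationOp` below. -/
def concentrationOp (φ : L2R) (Ω : Set (ℝ × ℝ)) : L2R →L[ℂ] L2R :=
  open Classical in
  if h : ∃ T : L2R →L[ℂ] L2R, ∀ f g : L2R, inner ℂ g (T f) = energyForm φ Ω f g
  then h.choose else 0

/-- The dilated region `Ω_r = {(rτ, rσ) : (τ,σ) ∈ Ω}`. -/
def dilatedRegion (r : ℝ) (Ω : Set (ℝ × ℝ)) : Set (ℝ × ℝ) :=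
  (fun z : ℝ × ℝ => (r * z.1, r * z.2)) '' Ω

/-- `lam 0 ≥ lam 1 ≥ ⋯ ≥ 0` is the sequence of eigenvalues of `T`, repeated according to
multiplicity, with orthonormal eigenvectors `ψ 0, ψ 1, …`. The system is complete up to the
kernel of `T` : whatever is orthogonal to all `ψ k` is annihilated by `T`. (If `T` has infinitely
many positive eigenvalues as well as a nontrivial kernel, then no decreasing sequence can
enumerate a complete basis of eigenvectors; the missing eigenvalues are all zero.
If the `ψ k` are a complete orthonormal basis, the last condition holds trivially.) -/
structure IsEigensystem (T : L2R →L[ℂ] L2R) (ψ : ℕ → L2R) (lam : ℕ → ℝ) : Prop where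
  orthonormal : Orthonormal ℂ ψ
  apply_eq : ∀ k, T (ψ k) = (lam k : ℂ) • ψ k
  nonneg : ∀ k, 0 ≤ lam k
  antitone : Antitone lam
  complete : ∀ f : L2R, (∀ k, inner ℂ (ψ k) f = 0) → T f = 0

/-! Existence of the concentration operator. -/

theorem norm_timeFreqShift (τ σ : ℝ) (f : ℝ → ℂ) (t : ℝ) :
    ‖timeFreqShift τ σ f t‖ = ‖f (t + τ)‖ := by
  have h1 : (Real.pi * Complex.I * τ * σ : ℂ) = ((Real.pi * τ * σ : ℝ) : ℂ) * Complex.I := by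
    push_cast; ring
  have h2 (t : ℝ) : (2 * Real.pi * Complex.I * σ * t : ℂ)
      = ((2 * Real.pi * σ * t : ℝ) : ℂ) * Complex.I := by
    push_cast; ring
  simp only [timeFreqShift, norm_mul, h1, h2, Complex.norm_exp_ofReal_mul_I, one_mul]

theorem stronglyMeasurable_shift (φ : L2R) :
    StronglyMeasurable (fun p : (ℝ × ℝ) × ℝ => timeFreqShift p.1.1 p.1.2 φ p.2) := by
  have h : Measurable (φ : ℝ → ℂ) := (Lp.stronglyMeasurable φ).measurable
  apply Measurable.stronglyMeasurable
  unfold timeFreqShift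
  fun_prop

theorem memLp_shift (φ : L2R) (z : ℝ × ℝ) : MemLp (timeFreqShift z.1 z.2 φ) 2 volume := by
  have h : MemLp (fun t => φ (t + z.1)) 2 volume :=
    (Lp.memLp φ).comp_measurePreserving (measurePreserving_add_right volume z.1)
  refine h.of_le ?_ (Eventually.of_forall fun t => (norm_timeFreqShift _ _ _ t).le)
  exact ((stronglyMeasurable_shift φ).comp_measurable
    (measurable_prodMk_left (x := z))).aestronglyMeasurable

theorem norm_shift_toLp (φ : L2R) (z : ℝ × ℝ) : ‖(memLp_shift φ z).toLp‖ = ‖φ‖ := by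
  rw [Lp.norm_toLp, Lp.norm_def]
  congr 1
  rw [← eLpNorm_comp_measurePreserving (Lp.aestronglyMeasurable φ)
    (measurePreserving_add_right volume z.1)]
  exact eLpNorm_congr_norm_ae (Eventually.of_forall fun t => norm_timeFreqShift _ _ _ t)

/-- `S_φ f (z) = ⟨f, ρ(z) φ⟩`. -/
theorem gaborTransform_eq_inner (φ f : L2R) (z : ℝ × ℝ) :
    gaborTransform φ f z = inner ℂ (memLp_shift φ z).toLp f := by
  rw [L2.inner_def]
  refine integral_congr_ae ?_
  filter_upwards [(memLp_shift φ z).coeFn_toLp] with t ht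
  rw [ht, RCLike.inner_apply]

theorem norm_gaborTransform_le (φ f : L2R) (z : ℝ × ℝ) :
    ‖gaborTransform φ f z‖ ≤ ‖φ‖ * ‖f‖ := by
  rw [gaborTransform_eq_inner, ← norm_shift_toLp φ z]
  exact norm_inner_le_norm _ _

theorem stronglyMeasurable_gaborTransform (φ f : L2R) :
    StronglyMeasurable (gaborTransform φ f) := by
  have hf : Measurable (f : ℝ → ℂ) := (Lp.stronglyMeasurable f).measurable
  have h := (stronglyMeasurable_shift φ).measurable
  have : StronglyMeasurable (fun p : (ℝ × ℝ) × ℝ =>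
      f p.2 * (starRingEnd ℂ) (timeFreqShift p.1.1 p.1.2 φ p.2)) := by
    apply Measurable.stronglyMeasurable
    exact (hf.comp measurable_snd).mul (Complex.continuous_conj.measurable.comp h)
  exact this.integral_prod_right

theorem integrableOn_energy (φ f g : L2R) {Ω : Set (ℝ × ℝ)} (hΩ : volume Ω < ⊤) :
    IntegrableOn (fun z => (starRingEnd ℂ) (gaborTransform φ f z) * gaborTransform φ g z) Ω := by
  refine Measure.integrableOn_of_bounded (M := (‖φ‖ * ‖f‖) * (‖φ‖ * ‖g‖)) hΩ.ne ?_ ?_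
  · have h1 := (stronglyMeasurable_gaborTransform φ f).measurable
    have h2 := (stronglyMeasurable_gaborTransform φ g).measurable
    exact ((Complex.continuous_conj.measurable.comp h1).mul h2).aestronglyMeasurable
  · refine Eventually.of_forall fun z => ?_
    rw [norm_mul, RCLike.norm_conj]
    gcongr <;> exact norm_gaborTransform_le _ _ _

theorem exists_concentrationOp (φ : L2R) {Ω : Set (ℝ × ℝ)} (hΩ : volume Ω < ⊤) :
    ∃ T : L2R →L[ℂ] L2R, ∀ f g : L2R, inner ℂ g (T f) = energyForm φ Ω f g := by
  let B : L2R →ₗ⋆[ℂ] L2R →ₗ[ℂ] ℂ := LinearMap.mk₂'ₛₗ (starRingEnd ℂ) (RingHom.id ℂ)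
    (fun f g => ∫ z in Ω, (starRingEnd ℂ) (gaborTransform φ f z) * gaborTransform φ g z)
    (fun f f' g => by
      rw [← integral_add (integrableOn_energy φ f g hΩ) (integrableOn_energy φ f' g hΩ)]
      congr 1; ext z
      simp only [gaborTransform_eq_inner, inner_add_right, map_add, add_mul])
    (fun c f g => by
      rw [smul_eq_mul, ← integral_const_mul]
      congr 1; ext z
      simp only [gaborTransform_eq_inner, inner_smul_right, map_mul, mul_assoc])
    (fun f g g' => by
      rw [← integral_add (integrableOn_energy φ f g hΩ) (integrableOn_energy φ f g' hΩ)]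
      congr 1; ext z
      simp only [gaborTransform_eq_inner, inner_add_right, mul_add])
    (fun c f g => by
      rw [RingHom.id_apply, smul_eq_mul, ← integral_const_mul]
      congr 1; ext z
      simp only [gaborTransform_eq_inner, inner_smul_right]
      ring)
  let B' : L2R →L⋆[ℂ] L2R →L[ℂ] ℂ := B.mkContinuous₂ (‖φ‖ * ‖φ‖ * volume.real Ω) (by
    intro f g
    have h := norm_setIntegral_le_of_norm_le_const (μ := volume) (s := Ω)
      (f := fun z => (starRingEnd ℂ) (gaborTransform φ f z) * gaborTransform φ g z)
      (C := (‖φ‖ * ‖f‖) * (‖φ‖ * ‖g‖)) hΩ (fun z _ => by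
        rw [norm_mul, RCLike.norm_conj]
        gcongr <;> exact norm_gaborTransform_le _ _ _)
    refine h.trans (le_of_eq ?_)
    ring)
  refine ⟨InnerProductSpace.continuousLinearMapOfBilin B', fun f g => ?_⟩
  rw [← inner_conj_symm, InnerProductSpace.continuousLinearMapOfBilin_apply]
  change (starRingEnd ℂ) (∫ z in Ω, (starRingEnd ℂ) (gaborTransform φ f z)
    * gaborTransform φ g z) = _
  rw [← integral_conj]
  simp only [energyForm, map_mul, Complex.conj_conj]

/-- The defining property `⟨C_Ω f, g⟩ = E_Ω(f,g)` of the concentration operator. -/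
theorem inner_concentrationOp (φ : L2R) {Ω : Set (ℝ × ℝ)} (hΩ : volume Ω < ⊤) (f g : L2R) :
    inner ℂ g (concentrationOp φ Ω f) = energyForm φ Ω f g := by
  have h := exists_concentrationOp φ hΩ
  rw [concentrationOp, dif_pos h]
  exact h.choose_spec f g

end

/-! Write `v z` for the shifted window `ρ(z)φ`, a unit vector. Weakly, `C_Ω = ∫_Ω ⟨·, v z⟩ v z dz`
is a superposition of rank-one projections. By Bessel's inequality its trace is at most `area(Ω)`.
This forces it to be Hilbert–Schmidt, hence compact, and the spectral theorem provides the
eigensystem (`exists_eigensequence`).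

The sum of the squared eigenvalues is the squared Hilbert–Schmidt norm, `∬_{Ω×Ω} |⟨v z, v w⟩|² dw
dz` (`tsum_ofReal_sq_eigenvalues`). Time-frequency shifts compose up to a phase, so the integrand is
`F(w - z)` with `F = |S_φ φ|²` (`enorm_inner_shift`), and the orthogonality relation, a consequence
of Plancherel, gives `∫ F = ‖φ‖⁴ = 1` (`lintegral_enorm_gaborTransform_sq`).

For `Ω_r`, division by the area and Tonelli turn the double integral into `∫ F(u) |Ω ∩ (Ω - u/r)| /
|Ω| du`. The ratio is at most 1 and tends to 1 by continuity of translation, so dominated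
convergence gives the limit `∫ F = 1` (`tendsto_setLIntegral_sub_div_volume`). -/

/-! ### Decreasing enumerations -/

/-- Every real function on a countably infinite type whose strict superlevel sets at attained
values are finite can be enumerated in decreasing order. -/
theorem exists_equiv_nat_antitone {I : Type*} [Countable I] [Infinite I] (a : I → ℝ)
    (h : ∀ i, {j | a i < a j}.Finite) : ∃ e : ℕ ≃ I, Antitone (a ∘ e) := by
  obtain ⟨enc, henc⟩ := exists_injective_nat I
  -- `P j i` says that `j` precedes `i`: larger value first, ties broken by an injection into ℕ, so
  -- that every element has finitely many predecessors.
  let P : I → I → Prop := fun j i => a i < a j ∨ (a i = a j ∧ enc j < enc i)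
  have hfin : ∀ i, {j | P j i}.Finite := fun i => by
    refine ((h i).union ((Set.finite_Iio (enc i)).preimage henc.injOn)).subset ?_
    rintro j (hj | hj)
    · exact Or.inl hj
    · exact Or.inr hj.2
  have htrans : ∀ i j k, P i j → P j k → P i k := by
    rintro i j k (h1 | ⟨h1, h1'⟩) (h2 | ⟨h2, h2'⟩)
    · exact Or.inl (h2.trans h1)
    · exact Or.inl (h2 ▸ h1)
    · exact Or.inl (h1 ▸ h2)
    · exact Or.inr ⟨h2.trans h1, h1'.trans h2'⟩
  have hirr : ∀ i, ¬ P i i := by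
    rintro i (h1 | ⟨-, h1⟩) <;> exact lt_irrefl _ h1
  have htri : ∀ i j, i ≠ j → P i j ∨ P j i := by
    intro i j hij
    rcases lt_trichotomy (a i) (a j) with h1 | h1 | h1
    · exact Or.inr (Or.inl h1)
    · rcases lt_or_gt_of_ne (henc.ne hij) with h2 | h2
      · exact Or.inl (Or.inr ⟨h1.symm, h2⟩)
      · exact Or.inr (Or.inr ⟨h1, h2⟩)
    · exact Or.inl (Or.inl h1)
  let rank : I → ℕ := fun i => {j | P j i}.ncard
  have hrank : ∀ i j, P i j → rank i < rank j := fun i j hij =>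
    Set.ncard_lt_ncard ⟨fun k hk => htrans k i j hk hij, fun hs => hirr i (hs hij)⟩ (hfin j)
  have hinj : Function.Injective rank := by
    intro i j hij
    by_contra hne
    rcases htri i j hne with h1 | h1
    · exact (hrank _ _ h1).ne hij
    · exact (hrank _ _ h1).ne hij.symm
  have hr : (Set.range rank).Infinite := Set.infinite_range_of_injective hinj
  have : Infinite (Set.range rank) := hr.to_subtype
  -- Counting predecessors embeds `I` order-preservingly in ℕ, and an infinite subset of ℕ is order
  -- isomorphic to ℕ.
  let o := Nat.Subtype.orderIsoOfNat (Set.range rank)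
  let q := Equiv.ofInjective rank hinj
  refine ⟨o.toEquiv.trans q.symm, fun n m hnm => ?_⟩
  have hq : ∀ n, rank (q.symm (o n)) = o n := fun n =>
    congrArg Subtype.val (q.apply_symm_apply (o n))
  change a (q.symm (o m)) ≤ a (q.symm (o n))
  by_contra! hlt
  have h1 := hrank _ _ (Or.inl hlt : P (q.symm (o m)) (q.symm (o n)))
  rw [hq, hq] at h1
  exact absurd (o.monotone hnm) (not_le.mpr h1)

/-! ### Superpositions of rank-one projections: compactness, eigenvectors, Hilbert–Schmidt norm -/

section Frame

universe u

variable {Z : Type*} [MeasurableSpace Z] {H : Type u} [NormedAddCommGroup H]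
  [InnerProductSpace ℂ H]

/-- `T f = ∫ ⟨f, v z⟩ v z dν(z)` (in the weak sense) for a weakly measurable family of unit
vectors `v`. -/
structure IsFrameOperator (ν : Measure Z) (v : Z → H) (T : H →L[ℂ] H) : Prop where
  measurable : ∀ f, Measurable fun z => inner ℂ (v z) f
  norm_eq_one : ∀ z, ‖v z‖ = 1
  inner_apply : ∀ f g, inner ℂ g (T f)
    = ∫ z, inner ℂ (v z) f * (starRingEnd ℂ) (inner ℂ (v z) g) ∂ν

namespace IsFrameOperator

variable {ν : Measure Z} [IsFiniteMeasure ν] {v : Z → H} {T : H →L[ℂ] H}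

omit [IsFiniteMeasure ν] in
theorem norm_inner_le (hT : IsFrameOperator ν v T) (f : H) (z : Z) :
    ‖inner ℂ (v z) f‖ ≤ ‖f‖ := by
  simpa [hT.norm_eq_one z] using norm_inner_le_norm (𝕜 := ℂ) (v z) f

theorem integrable_inner_mul (hT : IsFrameOperator ν v T) (f g : H) :
    Integrable (fun z => inner ℂ (v z) f * (starRingEnd ℂ) (inner ℂ (v z) g)) ν := by
  refine Integrable.of_bound (C := ‖f‖ * ‖g‖)
    ((hT.measurable f).mul
      (Complex.continuous_conj.measurable.comp (hT.measurable g))).aestronglyMeasurable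
    (Eventually.of_forall fun z => ?_)
  rw [norm_mul, RCLike.norm_conj]
  gcongr <;> exact hT.norm_inner_le _ _

theorem integrable_sq (hT : IsFrameOperator ν v T) (f : H) :
    Integrable (fun z => ‖inner ℂ (v z) f‖ ^ 2) ν := by
  refine (hT.integrable_inner_mul f f).norm.congr (Eventually.of_forall fun z => ?_)
  simp only [norm_mul, RCLike.norm_conj, sq]

omit [IsFiniteMeasure ν] in
theorem inner_self (hT : IsFrameOperator ν v T) (f : H) :
    inner ℂ f (T f) = ((∫ z, ‖inner ℂ (v z) f‖ ^ 2 ∂ν : ℝ) : ℂ) := by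
  rw [hT.inner_apply, ← integral_complex_ofReal]
  congr 1; ext z
  rw [Complex.mul_conj, Complex.normSq_eq_norm_sq]

omit [IsFiniteMeasure ν] in
theorem re_inner_self (hT : IsFrameOperator ν v T) (f : H) :
    (inner ℂ f (T f)).re = ∫ z, ‖inner ℂ (v z) f‖ ^ 2 ∂ν := by
  rw [hT.inner_self, Complex.ofReal_re]

omit [IsFiniteMeasure ν] in
theorem re_inner_self_nonneg (hT : IsFrameOperator ν v T) (f : H) :
    0 ≤ (inner ℂ f (T f)).re := by
  rw [hT.re_inner_self]; positivity

theorem lintegral_enorm_sq (hT : IsFrameOperator ν v T) (f : H) :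
    ∫⁻ z, ‖inner ℂ (v z) f‖ₑ ^ 2 ∂ν = ENNReal.ofReal (inner ℂ f (T f)).re := by
  rw [hT.re_inner_self, ofReal_integral_eq_lintegral_ofReal (hT.integrable_sq f)
    (Eventually.of_forall fun z => by positivity)]
  congr 1; ext z
  rw [ENNReal.ofReal_pow (norm_nonneg _), ofReal_norm]

omit [IsFiniteMeasure ν] in
theorem isSymmetric (hT : IsFrameOperator ν v T) : (T : H →ₗ[ℂ] H).IsSymmetric := by
  intro f g
  rw [← inner_conj_symm]
  change (starRingEnd ℂ) (inner ℂ g (T f)) = inner ℂ f (T g)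
  rw [hT.inner_apply, hT.inner_apply, ← integral_conj]
  congr 1; ext z
  simp [mul_comm]

/-- The trace bound: Bessel's inequality for the unit vector `v z`, integrated over `z`. -/
theorem sum_re_inner_le (hT : IsFrameOperator ν v T) {ι : Type*} {e : ι → H}
    (he : Orthonormal ℂ e) (s : Finset ι) :
    ∑ i ∈ s, (inner ℂ (e i) (T (e i))).re ≤ ν.real Set.univ := by
  simp_rw [hT.re_inner_self]
  rw [← integral_finsetSum _ fun i _ => hT.integrable_sq _]
  refine (integral_mono (integrable_finsetSum _ fun i _ => hT.integrable_sq _)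
    (integrable_const (1 : ℝ)) fun z => ?_).trans_eq (by simp)
  have := he.sum_inner_products_le (v z) (s := s)
  simp_rw [norm_inner_symm (e _) (v z), hT.norm_eq_one z] at this
  simpa using this

theorem summable_re_inner (hT : IsFrameOperator ν v T) {ι : Type*} {e : ι → H}
    (he : Orthonormal ℂ e) : Summable fun i => (inner ℂ (e i) (T (e i))).re :=
  summable_of_sum_le (fun _ => hT.re_inner_self_nonneg _) (hT.sum_re_inner_le he)

/-- In `‖T e‖² = ∫ ⟨e, v⟩ ⟨v, T e⟩` the second factor is at most `‖T e‖`; a weighted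
arithmetic-geometric inequality lets half of `‖T e‖²` be absorbed on the left. Since the bound is
linear in the quadratic form, the trace bound makes `‖T e‖²` summable over an orthonormal system. -/
theorem norm_apply_sq_le (hT : IsFrameOperator ν v T) (e : H) :
    ‖T e‖ ^ 2 ≤ (ν.real Set.univ + 1) * (inner ℂ e (T e)).re := by
  -- The added 1 keeps `c` positive when `ν = 0`.
  set c : ℝ := ν.real Set.univ + 1
  have hc : 0 < c := by positivity
  have h1 : ‖T e‖ ^ 2
      ≤ ∫ z, (c / 2 * ‖inner ℂ (v z) e‖ ^ 2 + 1 / (2 * c) * ‖T e‖ ^ 2) ∂ν := by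
    have h2 : ‖T e‖ ^ 2 = ‖inner ℂ (T e) (T e)‖ := by
      rw [inner_self_eq_norm_sq_to_K]; simp
    nth_rewrite 1 [h2]
    rw [hT.inner_apply]
    refine norm_integral_le_of_norm_le
      (((hT.integrable_sq e).const_mul _).add (integrable_const _))
      (Eventually.of_forall fun z => ?_)
    rw [norm_mul, RCLike.norm_conj]
    have h3 := hT.norm_inner_le (T e) z
    have h4 : ‖inner ℂ (v z) e‖ * ‖inner ℂ (v z) (T e)‖ ≤ ‖inner ℂ (v z) e‖ * ‖T e‖ := by
      gcongr
    refine h4.trans ?_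
    have h5 : c / 2 * ‖inner ℂ (v z) e‖ ^ 2 + 1 / (2 * c) * ‖T e‖ ^ 2
        - ‖inner ℂ (v z) e‖ * ‖T e‖ = (c * ‖inner ℂ (v z) e‖ - ‖T e‖) ^ 2 / (2 * c) := by
      field_simp; ring
    have h6 : 0 ≤ (c * ‖inner ℂ (v z) e‖ - ‖T e‖) ^ 2 / (2 * c) := by positivity
    linarith
  rw [integral_add ((hT.integrable_sq e).const_mul _) (integrable_const _), integral_const_mul,
    ← hT.re_inner_self, integral_const, smul_eq_mul] at h1
  have h2 : ν.real Set.univ * (1 / (2 * c) * ‖T e‖ ^ 2) ≤ ‖T e‖ ^ 2 / 2 := by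
    have h3 : ν.real Set.univ / c ≤ 1 := by
      rw [div_le_one hc]; simp [c]
    have : ν.real Set.univ * (1 / (2 * c) * ‖T e‖ ^ 2)
        = (ν.real Set.univ / c) * (‖T e‖ ^ 2 / 2) := by field_simp
    rw [this]
    exact mul_le_of_le_one_left (by positivity) h3
  linarith

/-- `T` is the norm limit of the finite-rank operators `∑ ⟨b i, ·⟩ T (b i)` over a Hilbert basis: by
Cauchy–Schwarz the norm of a finite partial sum is controlled by the summable `‖T (b i)‖²`. -/
theorem isCompactOperator [CompleteSpace H] (hT : IsFrameOperator ν v T) :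
    IsCompactOperator T := by
  obtain ⟨w, b, -⟩ := exists_hilbertBasis ℂ H
  let R : w → H →L[ℂ] H := fun i => (innerSL ℂ (b i)).smulRight (T (b i))
  have hR : ∀ i, IsCompactOperator (R i) := fun i =>
    (isCompactOperator_of_locallyCompactSpace_dom (innerSL ℂ (b i))).clm_comp
      (ContinuousLinearMap.toSpanSingleton ℂ (T (b i)))
  have hsq : Summable fun i => ‖T (b i)‖ ^ 2 :=
    Summable.of_nonneg_of_le (fun _ => by positivity) (fun i => hT.norm_apply_sq_le (b i))
      ((hT.summable_re_inner b.orthonormal).mul_left _)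
  have hbound : ∀ t : Finset w, ‖∑ i ∈ t, R i‖ ≤ √(∑ i ∈ t, ‖T (b i)‖ ^ 2) := by
    intro t
    refine ContinuousLinearMap.opNorm_le_bound _ (Real.sqrt_nonneg _) fun f => ?_
    rw [_root_.sum_apply]
    calc ‖∑ i ∈ t, R i f‖ ≤ ∑ i ∈ t, ‖inner ℂ (b i) f‖ * ‖T (b i)‖ := by
          refine norm_sum_le_of_le _ fun i _ => ?_
          simp [R, norm_smul]
      _ ≤ √(∑ i ∈ t, ‖inner ℂ (b i) f‖ ^ 2) * √(∑ i ∈ t, ‖T (b i)‖ ^ 2) :=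
          Real.sum_mul_le_sqrt_mul_sqrt _ _ _
      _ ≤ ‖f‖ * √(∑ i ∈ t, ‖T (b i)‖ ^ 2) := by
          gcongr
          exact Real.sqrt_le_iff.mpr ⟨norm_nonneg _, b.orthonormal.sum_inner_products_le f⟩
      _ = _ := mul_comm _ _
  have hsum : Summable R := by
    rw [summable_iff_vanishing_norm]
    intro ε hε
    obtain ⟨s, hs⟩ := summable_iff_vanishing_norm.mp hsq (ε ^ 2) (by positivity)
    refine ⟨s, fun t ht => (hbound t).trans_lt ?_⟩
    rw [Real.sqrt_lt' hε]
    exact (le_abs_self _).trans_lt (hs t ht)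
  have hTR : T = ∑' i, R i := by
    ext f
    have h1 : HasSum (fun i => R i f) ((∑' i, R i) f) :=
      hsum.hasSum.mapL (ContinuousLinearMap.apply ℂ H f)
    have h2 : HasSum (fun i => R i f) (T f) := by
      have := (b.hasSum_repr f).mapL T
      simpa [R, b.repr_apply_apply] using this
    exact h2.unique h1
  rw [hTR]
  refine isCompactOperator_of_tendsto hsum.hasSum (Eventually.of_forall fun s => ?_)
  induction s using Finset.cons_induction with
  | empty => simpa using (isCompactOperator_zero : IsCompactOperator (0 : H → H))
  | cons i s his ih =>
    rw [Finset.sum_cons]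
    exact (hR i).add ih

omit [IsFiniteMeasure ν] in
theorem eq_ofReal_of_apply_eq (hT : IsFrameOperator ν v T) {x : H} (hx : ‖x‖ = 1) {μ : ℂ}
    (h : T x = μ • x) : μ = ((inner ℂ x (T x)).re : ℂ) := by
  have h1 : inner ℂ x (T x) = μ := by
    rw [h, inner_smul_right, inner_self_eq_norm_sq_to_K, hx]; simp
  rw [hT.re_inner_self, ← hT.inner_self, h1]

/-- An orthonormal set of eigenvectors with nonzero eigenvalues, complete up to the kernel. -/
theorem exists_orthonormal_eigenvectors [CompleteSpace H] (hT : IsFrameOperator ν v T) :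
    ∃ U : Set H, Orthonormal ℂ ((↑) : U → H) ∧
      (∀ x ∈ U, ∃ μ : ℂ, μ ≠ 0 ∧ T x = μ • x) ∧
      ∀ f, (∀ x ∈ U, inner ℂ x f = 0) → T f = 0 := by
  have hc := hT.isCompactOperator
  let V : {μ : ℂ // μ ≠ 0} → Submodule ℂ H := fun μ =>
    Module.End.eigenspace (T : Module.End ℂ H) μ
  have hfd : ∀ μ, FiniteDimensional ℂ (V μ) := fun μ =>
    ContinuousLinearMap.finite_dimensional_eigenspace hc μ.1 μ.2
  have hcompl : ∀ μ, CompleteSpace (V μ) := fun μ => FiniteDimensional.complete ℂ _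
  choose w b hb using fun μ => exists_hilbertBasis ℂ (V μ)
  have hort : Orthonormal ℂ (fun p : Σ μ, w μ => ((b p.1 p.2 : V p.1) : H)) :=
    (hT.isSymmetric.orthogonalFamily_eigenspaces.comp
      Subtype.val_injective).orthonormal_sigma_orthonormal fun μ => (b μ).orthonormal
  refine ⟨Set.range fun p : Σ μ, w μ => ((b p.1 p.2 : V p.1) : H), hort.toSubtypeRange, ?_, ?_⟩
  · rintro _ ⟨p, rfl⟩
    exact ⟨p.1, p.1.2, Module.End.mem_eigenspace_iff.mp (b p.1 p.2 : V p.1).2⟩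
  · intro f hf
    have hV : ∀ μ (k : V μ), inner ℂ f (k : H) = 0 := by
      intro μ k
      have h1 := (((b μ).hasSum_repr k).mapL (V μ).subtypeL).mapL (innerSL ℂ f)
      refine h1.unique ?_
      convert! hasSum_zero with i
      have h2 : inner ℂ f ((b μ i : V μ) : H) = 0 := by
        rw [← inner_conj_symm, hf _ ⟨⟨μ, i⟩, rfl⟩, map_zero]
      simp [h2]
    -- By symmetry `⟨T f, k⟩ = μ ⟨f, k⟩` for `k` in the eigenspace of `μ`. This vanishes for `μ = 0`
    -- trivially and otherwise by the choice of `f`; the eigenspaces together have trivial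
    -- orthogonal complement.
    have h1 : T f ∈ (⨆ μ, Module.End.eigenspace (T : Module.End ℂ H) μ)ᗮ := by
      rw [← Submodule.iInf_orthogonal, Submodule.mem_iInf]
      intro μ
      rw [Submodule.mem_orthogonal']
      intro k hk
      have h3 : T k = μ • k := Module.End.mem_eigenspace_iff.mp hk
      have h2 : inner ℂ (T f) k = inner ℂ f (T k) := hT.isSymmetric f k
      rw [h2, h3, inner_smul_right]
      rcases eq_or_ne μ 0 with rfl | hμ
      · simp
      · rw [hV ⟨μ, hμ⟩ ⟨k, hk⟩, mul_zero]
    rwa [ContinuousLinearMap.orthogonalComplement_iSup_eigenspaces_eq_bot hc hT.isSymmetric,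
      Submodule.mem_bot] at h1

/-- The eigenvectors of a frame operator can be enumerated with decreasing eigenvalues. -/
theorem exists_eigensequence [CompleteSpace H] (hH : ¬ FiniteDimensional ℂ H)
    (hT : IsFrameOperator ν v T) :
    ∃ (ψ : ℕ → H) (lam : ℕ → ℝ), Orthonormal ℂ ψ ∧ (∀ k, T (ψ k) = (lam k : ℂ) • ψ k) ∧
      (∀ k, 0 ≤ lam k) ∧ Antitone lam ∧ ∀ f, (∀ k, inner ℂ (ψ k) f = 0) → T f = 0 := by
  obtain ⟨U, hU, hUe, hUc⟩ := hT.exists_orthonormal_eigenvectors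
  let a : H → ℝ := fun x => (inner ℂ x (T x)).re
  have ha : ∀ x, 0 ≤ a x := hT.re_inner_self_nonneg
  have hapos : ∀ x ∈ U, 0 < a x ∧ T x = (a x : ℂ) • x := by
    intro x hx
    obtain ⟨μ, hμ, h⟩ := hUe x hx
    have h1 := hT.eq_ofReal_of_apply_eq (hU.1 ⟨x, hx⟩) h
    refine ⟨lt_of_le_of_ne (ha x) fun h0 => hμ ?_, h1 ▸ h⟩
    rw [h1]
    exact_mod_cast h0.symm
  -- It suffices to find a countably infinite system containing `U` in which a zero eigenvalue
  -- occurs only if finitely many are positive: otherwise the zero would have no place in a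
  -- decreasing sequence.
  suffices hJ : ∃ J : Set H, U ⊆ J ∧ Orthonormal ℂ ((↑) : J → H) ∧ J.Countable ∧ J.Infinite ∧
      (∀ x ∈ J, T x = (a x : ℂ) • x) ∧ ∀ x ∈ J, a x = 0 → {y ∈ J | 0 < a y}.Finite by
    obtain ⟨J, hUJ, hJo, hJc, hJi, hJT, hJ0⟩ := hJ
    have : Countable J := hJc.to_subtype
    have : Infinite J := hJi.to_subtype
    obtain ⟨e, he⟩ := exists_equiv_nat_antitone (fun x : J => a x) (by
      intro x
      rcases (ha x).eq_or_lt with h0 | h0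
      · refine Set.Finite.of_finite_image (f := Subtype.val)
          ((hJ0 x x.2 h0.symm).subset ?_) Subtype.val_injective.injOn
        rintro _ ⟨y, hy, rfl⟩
        exact ⟨y.2, h0.trans_lt hy⟩
      -- A summable family exceeds a positive threshold only finitely often.
      · have h1 := (hT.summable_re_inner hJo).tendsto_cofinite_zero
        have h2 := h1.eventually_lt_const h0
        refine (Filter.eventually_cofinite.mp h2).subset fun y hy => ?_
        exact not_lt.mpr (le_of_lt hy))
    refine ⟨fun k => e k, fun k => a (e k), hJo.comp _ e.injective, fun k => hJT _ (e k).2,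
      fun k => ha _, he, fun f hf => hUc f fun x hx => ?_⟩
    simpa using hf (e.symm ⟨x, hUJ hx⟩)
  -- A finite `U` is padded with countably many orthonormal kernel vectors from a Hilbert basis
  -- extending it. An infinite `U` is used as it is; it is countable because its eigenvalues are
  -- positive and summable.
  by_cases hfin : U.Finite
  · obtain ⟨w, b, hUw, hb⟩ := hU.exists_hilbertBasis_extension
    have hwo : Orthonormal ℂ ((↑) : w → H) := hb ▸ b.orthonormal
    have hw : w.Infinite := by
      intro hwf
      refine hH ?_
      have : Fintype w := hwf.fintype
      exact Module.Basis.finiteDimensional_of_finite (b.toOrthonormalBasis).toBasis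
    have hdiff : (w \ U).Infinite := hw.sdiff hfin
    obtain ⟨C, hCs, hCi, hCc⟩ : ∃ C ⊆ w \ U, C.Infinite ∧ C.Countable :=
      ⟨_, Set.range_subset_iff.mpr fun n => (hdiff.natEmbedding _ n).2,
        Set.infinite_range_of_injective
          (Subtype.val_injective.comp (hdiff.natEmbedding _).injective), Set.countable_range _⟩
    have hC0 : ∀ x ∈ C, T x = 0 := by
      intro x hx
      refine hUc x fun y hy => ?_
      have hne : (⟨y, hUw hy⟩ : w) ≠ ⟨x, (hCs hx).1⟩ := by
        intro h
        have h' : y = x := congrArg Subtype.val h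
        exact (hCs hx).2 (h' ▸ hy)
      exact hwo.2 hne
    have hCa : ∀ x ∈ C, a x = 0 := fun x hx => by simp [a, hC0 x hx]
    have hJw : U ∪ C ⊆ w := Set.union_subset hUw fun x hx => (hCs hx).1
    refine ⟨U ∪ C, Set.subset_union_left,
      hwo.comp (Set.inclusion hJw) (Set.inclusion_injective hJw), hfin.countable.union hCc,
      hCi.mono Set.subset_union_right, ?_, ?_⟩
    · rintro x (hx | hx)
      · exact (hapos x hx).2
      · rw [hC0 x hx, hCa x hx]; simp
    · rintro x - -
      refine hfin.subset ?_
      rintro y ⟨hy | hy, hy'⟩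
      · exact hy
      · exact absurd (hCa y hy) hy'.ne'
  · refine ⟨U, subset_rfl, hU, ?_, hfin, fun x hx => (hapos x hx).2,
      fun x hx h0 => absurd h0 (hapos x hx).1.ne'⟩
    have h1 := (hT.summable_re_inner hU).countable_support
    have h2 : (Function.support fun x : U => (inner ℂ (x : H) (T x)).re) = Set.univ := by
      ext x
      simpa using (hapos x x.2).1.ne'
    rw [h2, Set.countable_univ_iff] at h1
    exact Set.countable_coe_iff.mp h1

/-- The sum of the squares of the eigenvalues is the squared `L²` norm of the reproducing
kernel. -/
theorem tsum_ofReal_sq_eigenvalues [CompleteSpace H] (hT : IsFrameOperator ν v T) {ψ : ℕ → H}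
    {lam : ℕ → ℝ} (hψ : Orthonormal ℂ ψ) (happ : ∀ k, T (ψ k) = (lam k : ℂ) • ψ k)
    (hker : ∀ f, (∀ k, inner ℂ (ψ k) f = 0) → T f = 0) :
    ∑' k, ENNReal.ofReal (|lam k| ^ 2) = ∫⁻ z, ∫⁻ w, ‖inner ℂ (v w) (v z)‖ₑ ^ 2 ∂ν ∂ν := by
  have hlam : ∀ k, (inner ℂ (ψ k) (T (ψ k))).re = lam k := fun k => by
    rw [happ, inner_smul_right, inner_self_eq_norm_sq_to_K, hψ.1 k]; simp
  have hnn : ∀ k, 0 ≤ lam k := fun k => hlam k ▸ hT.re_inner_self_nonneg _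
  have hexp : ∀ f, ENNReal.ofReal (inner ℂ f (T f)).re
      = ∑' k, ENNReal.ofReal (lam k) * ‖inner ℂ f (ψ k)‖ₑ ^ 2 := by
    intro f
    have hs : Summable fun k => inner ℂ (ψ k) f • ψ k := by
      have := (hψ.orthogonalFamily.summable_iff_norm_sq_summable
        fun k => inner ℂ (ψ k) f).mpr (hψ.inner_products_summable f)
      simpa using this
    -- The difference of `f` and its projection onto the closed span of the `ψ k` is orthogonal to
    -- every `ψ k`, so `T` kills it.
    have hfg : T f = T (∑' k, inner ℂ (ψ k) f • ψ k) := by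
      rw [← sub_eq_zero, ← map_sub]
      refine hker _ fun j => ?_
      rw [inner_sub_right, sub_eq_zero]
      refine HasSum.unique ?_ (hs.hasSum.mapL (innerSL ℂ (ψ j)))
      convert! hasSum_ite_eq j (inner ℂ (ψ j) f) with k
      rw [innerSL_apply_apply, inner_smul_right, orthonormal_iff_ite.mp hψ]
      by_cases h : j = k
      · subst h; simp
      · simp [h, Ne.symm h]
    have h1 := ((hs.hasSum.mapL T).mapL (innerSL ℂ f)).mapL Complex.reCLM
    rw [← hfg] at h1
    have h2 : ∀ k, Complex.reCLM (innerSL ℂ f (T (inner ℂ (ψ k) f • ψ k)))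
        = lam k * ‖inner ℂ f (ψ k)‖ ^ 2 := by
      intro k
      rw [map_smul, happ, smul_smul, innerSL_apply_apply, inner_smul_right,
        ← inner_conj_symm (ψ k) f, mul_assoc, mul_left_comm, mul_comm ((starRingEnd ℂ) _),
        Complex.mul_conj, Complex.normSq_eq_norm_sq, ← Complex.ofReal_mul]
      rfl
    simp_rw [h2] at h1
    have h3 : (inner ℂ f (T f)).re = ∑' k, lam k * ‖inner ℂ f (ψ k)‖ ^ 2 := h1.tsum_eq.symm
    rw [h3, ENNReal.ofReal_tsum_of_nonneg (fun k => mul_nonneg (hnn k) (by positivity))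
      h1.summable]
    congr 1; ext k
    rw [ENNReal.ofReal_mul (hnn k), ENNReal.ofReal_pow (norm_nonneg _), ofReal_norm]
  -- The inner integral is `⟨T (v z), v z⟩ = ∑ λ_k |⟨v z, ψ_k⟩|²`; integrating over `z` turns each
  -- term into `λ_k ⟨T ψ_k, ψ_k⟩ = λ_k²`.
  simp_rw [hT.lintegral_enorm_sq, hexp]
  rw [lintegral_tsum fun k =>
    (((hT.measurable (ψ k)).enorm.pow_const 2).const_mul _).aemeasurable]
  congr 1; ext k
  rw [lintegral_const_mul _ ((hT.measurable (ψ k)).enorm.pow_const 2), hT.lintegral_enorm_sq,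
    hlam, sq_abs, sq, ENNReal.ofReal_mul (hnn k)]

end IsFrameOperator

end Frame

/-! ### Plancherel's theorem and the orthogonality relation -/

theorem L2R.lintegral_enorm_sq (f : L2R) : ∫⁻ x, ‖f x‖ₑ ^ 2 = ‖f‖ₑ ^ 2 := by
  rw [Lp.enorm_def, eLpNorm_eq_lintegral_rpow_enorm_toReal (by norm_num) (by norm_num),
    ← ENNReal.rpow_natCast, ← ENNReal.rpow_mul]
  simp

open FourierTransform SchwartzMap ContDiff in
/-- Plancherel's theorem for functions in `L¹ ∩ L²`. -/
theorem lintegral_enorm_fourier_sq {g : ℝ → ℂ} (hg : Integrable g) (hg2 : MemLp g 2) :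
    ∫⁻ ξ, ‖𝓕 g ξ‖ₑ ^ 2 = ∫⁻ t, ‖g t‖ₑ ^ 2 := by
  have hcont : Continuous (𝓕 g) :=
    VectorFourier.fourierIntegral_continuous Real.continuous_fourierChar
      (by exact continuous_inner) hg
  -- The `L²` Fourier transform and the Fourier integral agree because they have equal integrals
  -- against test functions: in both cases the transform can be moved onto the test function.
  have hae : ∀ᵐ ξ, (𝓕 hg2.toLp : L2R) ξ = 𝓕 g ξ := by
    refine ae_eq_of_integral_contDiff_smul_eq
      ((Lp.memLp (𝓕 hg2.toLp : L2R)).locallyIntegrable one_le_two) hcont.locallyIntegrable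
      fun s hs hsc => ?_
    have hs₁ : HasCompactSupport (Complex.ofRealCLM ∘ s) := hsc.comp_left rfl
    have hs₂ : ContDiff ℝ ∞ (Complex.ofRealCLM ∘ s) := Complex.ofRealCLM.contDiff.comp hs
    let S : 𝓢(ℝ, ℂ) := hs₁.toSchwartzMap hs₂
    have hS : ∀ x, S x = (s x : ℂ) := fun x => rfl
    have h1 := DFunLike.congr_fun (Lp.fourier_toTemperedDistribution_eq hg2.toLp) S
    rw [TemperedDistribution.fourier_apply, Lp.toTemperedDistribution_apply,
      Lp.toTemperedDistribution_apply] at h1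
    have h2 : ∫ x, (𝓕 S) x • (hg2.toLp : L2R) x = ∫ x, (𝓕 S) x • g x := by
      refine integral_congr_ae ?_
      filter_upwards [hg2.coeFn_toLp] with x hx
      rw [hx]
    have h3 : ∫ x, (𝓕 S) x • g x = ∫ x, S x • 𝓕 g x := by
      have := VectorFourier.integral_fourierIntegral_smul_eq_flip (μ := (volume : Measure ℝ))
        (ν := (volume : Measure ℝ)) (L := innerₗ ℝ) Real.continuous_fourierChar
        (by exact continuous_inner) S.integrable hg
      rw [flip_innerₗ] at this
      exact this
    rw [h2, h3] at h1
    simpa [hS] using h1.symm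
  calc ∫⁻ ξ, ‖𝓕 g ξ‖ₑ ^ 2 = ∫⁻ ξ, ‖(𝓕 hg2.toLp : L2R) ξ‖ₑ ^ 2 := by
        refine lintegral_congr_ae ?_
        filter_upwards [hae] with x hx
        rw [hx]
    _ = ∫⁻ t, ‖(hg2.toLp : L2R) t‖ₑ ^ 2 := by
        rw [L2R.lintegral_enorm_sq, L2R.lintegral_enorm_sq, ← ofReal_norm, ← ofReal_norm, Lp.norm_fourier_eq]
    _ = ∫⁻ t, ‖g t‖ₑ ^ 2 := by
        refine lintegral_congr_ae ?_
        filter_upwards [hg2.coeFn_toLp] with x hx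
        rw [hx]

theorem enorm_exp_ofReal_mul_I (x : ℝ) : ‖Complex.exp (x * Complex.I)‖ₑ = 1 := by
  rw [← ofReal_norm, Complex.norm_exp_ofReal_mul_I, ENNReal.ofReal_one]

open FourierTransform in
-- For fixed `τ` the Gabor transform is a windowed Fourier transform in `σ`, up to a unimodular
-- factor; Plancherel then applies for almost every `τ`.
theorem enorm_gaborTransform_eq_fourier (φ f : L2R) (τ σ : ℝ) :
    ‖gaborTransform φ f (τ, σ)‖ₑ
      = ‖𝓕 (fun t => f t * (starRingEnd ℂ) (φ (t + τ))) σ‖ₑ := by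
  have h : gaborTransform φ f (τ, σ) = Complex.exp ((-Real.pi * τ * σ : ℝ) * Complex.I)
      * 𝓕 (fun t => f t * (starRingEnd ℂ) (φ (t + τ))) σ := by
    rw [gaborTransform, Real.fourier_eq', ← integral_const_mul]
    congr 1; ext t
    simp only [timeFreqShift, map_mul, ← Complex.exp_conj, Complex.conj_I, Complex.conj_ofReal,
      Complex.conj_ofNat, smul_eq_mul]
    have h1 : ∀ a b c d : ℂ, a * (Complex.exp b * Complex.exp c * d)
        = Complex.exp (b + c) * (a * d) := fun a b c d => by rw [Complex.exp_add]; ring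
    have h2 : ∀ b c d : ℂ, Complex.exp b * (Complex.exp c * d)
        = Complex.exp (b + c) * d := fun b c d => by rw [Complex.exp_add]; ring
    rw [h1, h2]
    congr 2
    simp
    ring
  rw [h, enorm_mul, enorm_exp_ofReal_mul_I, one_mul]

/-- The orthogonality relation `‖S_φ f‖ = ‖f‖ ‖φ‖` for the Gabor transform. -/
theorem lintegral_enorm_gaborTransform_sq (φ f : L2R) :
    ∫⁻ z, ‖gaborTransform φ f z‖ₑ ^ 2 = ‖f‖ₑ ^ 2 * ‖φ‖ₑ ^ 2 := by
  have hφ : Measurable (φ : ℝ → ℂ) := (Lp.stronglyMeasurable φ).measurable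
  have hf : Measurable (f : ℝ → ℂ) := (Lp.stronglyMeasurable f).measurable
  have hm : Measurable fun z => ‖gaborTransform φ f z‖ₑ ^ 2 :=
    (stronglyMeasurable_gaborTransform φ f).measurable.enorm.pow_const 2
  have hm2 : Measurable fun p : ℝ × ℝ => ‖f p.2 * (starRingEnd ℂ) (φ (p.2 + p.1))‖ₑ ^ 2 := by
    have := Complex.continuous_conj.measurable
    fun_prop
  have hprod : ∫⁻ τ, ∫⁻ t, ‖f t * (starRingEnd ℂ) (φ (t + τ))‖ₑ ^ 2
      = ‖f‖ₑ ^ 2 * ‖φ‖ₑ ^ 2 := by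
    rw [lintegral_lintegral_swap hm2.aemeasurable]
    have h1 : ∀ t, ∫⁻ τ, ‖f t * (starRingEnd ℂ) (φ (t + τ))‖ₑ ^ 2
        = ‖f t‖ₑ ^ 2 * ‖φ‖ₑ ^ 2 := by
      intro t
      simp_rw [enorm_mul, mul_pow, RCLike.enorm_conj]
      rw [lintegral_const_mul _ (by fun_prop), ← L2R.lintegral_enorm_sq φ,
        lintegral_add_left_eq_self (fun s => ‖φ s‖ₑ ^ 2) t]
    simp_rw [h1]
    rw [lintegral_mul_const _ (by fun_prop), L2R.lintegral_enorm_sq]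
  rw [Measure.volume_eq_prod, lintegral_prod _ hm.aemeasurable, ← hprod]
  -- The product of two `L²` functions is always in `L¹`, but in `L²` only for almost every shift
  -- `τ`, by Tonelli.
  have hfin : ∀ᵐ τ, ∫⁻ t, ‖f t * (starRingEnd ℂ) (φ (t + τ))‖ₑ ^ 2 < ⊤ := by
    refine ae_lt_top hm2.lintegral_prod_right' ?_
    rw [hprod]
    exact ENNReal.mul_ne_top (by simp) (by simp)
  refine lintegral_congr_ae ?_
  filter_upwards [hfin] with τ hτ
  simp_rw [enorm_gaborTransform_eq_fourier]
  have hφτ : MemLp (fun t => (starRingEnd ℂ) (φ (t + τ))) 2 :=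
    ((Lp.memLp φ).comp_measurePreserving (measurePreserving_add_right volume τ)).star
  refine lintegral_enorm_fourier_sq ((Lp.memLp f).integrable_mul hφτ) ⟨?_, ?_⟩
  · exact (Lp.memLp f).1.mul hφτ.1
  · rw [eLpNorm_lt_top_iff_lintegral_rpow_enorm_lt_top (by norm_num) (by norm_num)]
    simpa using hτ

/-! ### The reproducing kernel and the concentration operator -/

/-- The modulus of the reproducing kernel is translation invariant. -/
theorem enorm_inner_shift (φ : L2R) (z w : ℝ × ℝ) :
    ‖inner ℂ (memLp_shift φ w).toLp (memLp_shift φ z).toLp‖ₑ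
      = ‖gaborTransform φ φ (w - z)‖ₑ := by
  obtain ⟨τ, σ⟩ := z
  obtain ⟨τ', σ'⟩ := w
  have h0 : inner ℂ (memLp_shift φ (τ', σ')).toLp (memLp_shift φ (τ, σ)).toLp
      = ∫ t, timeFreqShift τ σ φ t * (starRingEnd ℂ) (timeFreqShift τ' σ' φ t) := by
    rw [← gaborTransform_eq_inner, gaborTransform]
    refine integral_congr_ae ?_
    filter_upwards [(memLp_shift φ (τ, σ)).coeFn_toLp] with t ht
    rw [ht]
  -- The phase is the symplectic cocycle of the Heisenberg group; it appears after substituting `t -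
  -- τ` for `t`.
  have h : inner ℂ (memLp_shift φ (τ', σ')).toLp (memLp_shift φ (τ, σ)).toLp
      = Complex.exp ((Real.pi * (τ * σ' - τ' * σ) : ℝ) * Complex.I)
        * gaborTransform φ φ ((τ', σ') - (τ, σ)) := by
    rw [h0, ← integral_sub_right_eq_self _ τ, gaborTransform, ← integral_const_mul]
    congr 1; ext t
    simp only [timeFreqShift, map_mul, ← Complex.exp_conj, Complex.conj_I, Complex.conj_ofReal,
      Complex.conj_ofNat, Prod.fst_sub, Prod.snd_sub]
    have h1 : ∀ a b c d x y : ℂ, Complex.exp a * Complex.exp b * x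
        * (Complex.exp c * Complex.exp d * y) = Complex.exp (a + b + c + d) * (x * y) :=
      fun a b c d x y => by simp only [Complex.exp_add]; ring
    have h2 : ∀ a b c x y : ℂ, Complex.exp a * (x * (Complex.exp b * Complex.exp c * y))
        = Complex.exp (a + b + c) * (x * y) :=
      fun a b c x y => by simp only [Complex.exp_add]; ring
    rw [h1, h2]
    have e1 : t - τ + τ = t := by ring
    have e2 : t - τ + τ' = t + (τ' - τ) := by ring
    rw [e1, e2]
    congr 2
    push_cast
    ring
  rw [h, enorm_mul, enorm_exp_ofReal_mul_I, one_mul]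

theorem isFrameOperator_concentrationOp {φ : L2R} (hφ : ‖φ‖ = 1) {Ω : Set (ℝ × ℝ)}
    (hΩ : volume Ω < ⊤) :
    IsFrameOperator (volume.restrict Ω) (fun z => (memLp_shift φ z).toLp)
      (concentrationOp φ Ω) where
  measurable f := by
    simp_rw [← gaborTransform_eq_inner]
    exact (stronglyMeasurable_gaborTransform φ f).measurable
  norm_eq_one z := (norm_shift_toLp φ z).trans hφ
  inner_apply f g := by
    rw [inner_concentrationOp φ hΩ]
    simp_rw [energyForm, gaborTransform_eq_inner]

/-- Indicators of the intervals `[n, n+1)` are orthonormal. Infinite dimension is what allows an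
infinite orthonormal sequence even if the operator has finite rank. -/
theorem not_finiteDimensional_L2R : ¬ FiniteDimensional ℂ L2R := by
  intro h
  let e : ℕ → L2R := fun n =>
    indicatorConstLp 2 (measurableSet_Ico (a := (n : ℝ)) (b := n + 1)) (by simp) (1 : ℂ)
  have he : Orthonormal ℂ e := by
    constructor
    · intro n
      simp [e, norm_indicatorConstLp]
    · intro m n hmn
      change inner ℂ (e m) (e n) = 0
      rw [L2.inner_indicatorConstLp_one, setIntegral_eq_zero_of_ae_eq_zero]
      filter_upwards [indicatorConstLp_coeFn (p := 2) (hs := measurableSet_Ico (a := (n : ℝ))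
        (b := n + 1)) (hμs := by simp) (c := (1 : ℂ))] with x hx hxm
      rw [hx, Set.indicator_of_notMem]
      intro hxn
      refine hmn ?_
      have h1 : (m : ℝ) < n + 1 := hxm.1.trans_lt hxn.2
      have h2 : (n : ℝ) < m + 1 := hxn.1.trans_lt hxm.2
      norm_cast at h1 h2
      omega
  have := he.linearIndependent.finite
  exact not_finite ℕ

/-! ### Dilations and autocorrelations of plane sets -/

open scoped Pointwise

theorem dilatedRegion_eq_smul (r : ℝ) (Ω : Set (ℝ × ℝ)) : dilatedRegion r Ω = r • Ω := rfl

theorem volume_smul_plane (r : ℝ) (Ω : Set (ℝ × ℝ)) :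
    volume (r • Ω) = ENNReal.ofReal (r ^ 2) * volume Ω := by
  rw [Measure.addHaar_smul]
  simp

theorem concentrationOp_congr (φ : L2R) {A B : Set (ℝ × ℝ)} (h : A =ᵐ[volume] B) :
    concentrationOp φ A = concentrationOp φ B := by
  have hE : energyForm φ A = energyForm φ B := by
    funext f g
    rw [energyForm, energyForm, Measure.restrict_congr_set h]
  unfold concentrationOp
  rw [hE]

theorem smul_ae_eq_smul (r : ℝ) {A B : Set (ℝ × ℝ)} (hr : r ≠ 0) (h : A =ᵐ[volume] B) :
    (r • A : Set (ℝ × ℝ)) =ᵐ[volume] (r • B : Set (ℝ × ℝ)) := by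
  rw [ae_eq_set] at h ⊢
  rw [← Set.smul_set_sdiff₀ hr, ← Set.smul_set_sdiff₀ hr, volume_smul_plane, volume_smul_plane,
    h.1, h.2, mul_zero]
  simp

/-- The measure of `A ∩ (A - u)` tends to the measure of `A` as `u → 0`. -/
theorem tendsto_volume_inter_preimage_add {A : Set (ℝ × ℝ)} (hA : MeasurableSet A)
    (hfin : volume A ≠ ⊤) :
    Tendsto (fun u => volume (A ∩ (u + ·) ⁻¹' A)) (𝓝 0) (𝓝 (volume A)) := by
  let f : ℝ × ℝ → C(ℝ × ℝ, ℝ × ℝ) := fun u => ⟨fun z => u + z, by fun_prop⟩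
  have hf : Continuous f := ContinuousMap.continuous_of_continuous_uncurry _ (by
    change Continuous fun p : (ℝ × ℝ) × (ℝ × ℝ) => p.1 + p.2
    fun_prop)
  have h := tendsto_measure_symmDiff_preimage_nhds_zero (μ := volume) (ν := volume)
    (hf.tendsto 0) (Eventually.of_forall fun u => measurePreserving_add_left volume u)
    (measurePreserving_add_left volume 0) hA.nullMeasurableSet hfin
  have h0 : f 0 ⁻¹' A = A := by
    ext z; simp [f]
  rw [h0] at h
  -- Every point of `A` lies in `A ∩ (A - u)` or in the symmetric difference of `A` and `A - u`,
  -- whose measure tends to 0. Hence the lower bound in the squeeze.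
  have h1 := ENNReal.Tendsto.sub (tendsto_const_nhds (x := volume A)) h (Or.inl hfin)
  rw [tsub_zero] at h1
  refine tendsto_of_tendsto_of_tendsto_of_le_of_le h1 tendsto_const_nhds (fun u => ?_)
    fun u => measure_mono Set.inter_subset_left
  rw [tsub_le_iff_right]
  refine (measure_mono fun z hz => ?_).trans (measure_union_le _ _)
  by_cases hzu : u + z ∈ A
  · exact Or.inl ⟨hz, hzu⟩
  · exact Or.inr (Or.inr ⟨hz, hzu⟩)

theorem measurable_volume_inter_preimage_add {A : Set (ℝ × ℝ)} (hA : MeasurableSet A) :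
    Measurable fun u : ℝ × ℝ => volume (A ∩ (u + ·) ⁻¹' A) := by
  have hS : MeasurableSet {p : (ℝ × ℝ) × (ℝ × ℝ) | p.2 ∈ A ∧ p.1 + p.2 ∈ A} :=
    (measurable_snd hA).inter ((measurable_fst.add measurable_snd) hA)
  exact measurable_measure_prodMk_left hS

/-- Substitute `w = u + z` and apply Tonelli: each difference `u` is weighted by the measure of the
`z ∈ A` with `u + z ∈ A`. -/
theorem setLIntegral_setLIntegral_sub {F : ℝ × ℝ → ENNReal} (hF : Measurable F)
    {A : Set (ℝ × ℝ)} (hA : MeasurableSet A) :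
    ∫⁻ z in A, ∫⁻ w in A, F (w - z) = ∫⁻ u, volume (A ∩ (u + ·) ⁻¹' A) * F u := by
  have hind : Measurable (A.indicator (1 : ℝ × ℝ → ENNReal)) := measurable_one.indicator hA
  have h1 : ∀ z, ∫⁻ w in A, F (w - z) = ∫⁻ u, A.indicator 1 (u + z) * F u := by
    intro z
    rw [← lintegral_indicator hA, ← lintegral_add_right_eq_self _ z]
    congr 1; ext u
    by_cases h : u + z ∈ A <;> simp [h]
  simp_rw [h1]
  rw [lintegral_lintegral_swap (by fun_prop)]
  congr 1; ext u
  rw [lintegral_mul_const _ (by fun_prop)]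
  congr 1
  have h2 : (fun z => A.indicator (1 : ℝ × ℝ → ENNReal) (u + z))
      = ((u + ·) ⁻¹' A).indicator 1 := rfl
  have hu : MeasurableSet ((u + ·) ⁻¹' A) := (measurable_const_add u) hA
  rw [h2, lintegral_indicator_one hu, Measure.restrict_apply hu, Set.inter_comm]

theorem volume_smul_inter_preimage_add {r : ℝ} (hr : 0 < r) (A : Set (ℝ × ℝ)) (u : ℝ × ℝ) :
    volume ((r • A) ∩ (u + ·) ⁻¹' (r • A))
      = ENNReal.ofReal (r ^ 2) * volume (A ∩ (r⁻¹ • u + ·) ⁻¹' A) := by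
  rw [← volume_smul_plane]
  congr 1
  ext z
  simp only [Set.mem_inter_iff, Set.mem_preimage, Set.mem_smul_set_iff_inv_smul_mem₀ hr.ne',
    smul_add]

/-- The normalized autocorrelation of a dilated set is an approximation of the constant `1`. -/
theorem tendsto_setLIntegral_sub_div_volume {F : ℝ × ℝ → ENNReal} (hF : Measurable F)
    (hFi : ∫⁻ u, F u ≠ ⊤) {A : Set (ℝ × ℝ)} (hA : MeasurableSet A) (hA0 : volume A ≠ 0)
    (hfin : volume A ≠ ⊤) :
    Tendsto (fun r : ℝ => (∫⁻ z in r • A, ∫⁻ w in r • A, F (w - z)) / volume (r • A)) atTop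
      (𝓝 (∫⁻ u, F u)) := by
  have hlim : Tendsto
      (fun r : ℝ => ∫⁻ u, volume (A ∩ (r⁻¹ • u + ·) ⁻¹' A) / volume A * F u) atTop
      (𝓝 (∫⁻ u, F u)) := by
    -- The overlap ratio is at most 1, so `F` itself dominates.
    refine tendsto_lintegral_filter_of_dominated_convergence F
      (Eventually.of_forall fun r => ?_) (Eventually.of_forall fun r => ae_of_all _ fun u => ?_)
      hFi (ae_of_all _ fun u => ?_)
    · exact (((measurable_volume_inter_preimage_add hA).comp
        (measurable_const_smul r⁻¹)).div_const _).mul hF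
    · refine mul_le_of_le_one_left zero_le (ENNReal.div_le_of_le_mul ?_)
      rw [one_mul]
      exact measure_mono Set.inter_subset_left
    · have h1 : Tendsto (fun r : ℝ => r⁻¹ • u) atTop (𝓝 0) := by
        simpa using (tendsto_inv_atTop_zero (𝕜 := ℝ)).smul_const u
      have h2 := ENNReal.Tendsto.mul_const (b := F u)
        (ENNReal.Tendsto.div_const ((tendsto_volume_inter_preimage_add hA hfin).comp h1)
          (Or.inr hA0)) (Or.inl (by rw [ENNReal.div_self hA0 hfin]; exact one_ne_zero))
      rwa [ENNReal.div_self hA0 hfin, one_mul] at h2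
  refine hlim.congr' ?_
  filter_upwards [eventually_gt_atTop 0] with r hr
  rw [setLIntegral_setLIntegral_sub hF (hA.const_smul₀ r), div_eq_mul_inv,
    ← lintegral_mul_const'' _ (by
      exact ((measurable_volume_inter_preimage_add (hA.const_smul₀ r)).mul hF).aemeasurable)]
  congr 1; ext u
  rw [volume_smul_inter_preimage_add hr, volume_smul_plane, mul_right_comm, ← div_eq_mul_inv,
    ENNReal.mul_div_mul_left _ _ (by simpa using hr.ne') ENNReal.ofReal_ne_top]

/-! ### Eigenvalues of the concentration operator and the limit -/

/-- The squared Hilbert-Schmidt norm of the concentration operator. -/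
theorem IsEigensystem.tsum_ofReal_sq {φ : L2R} (hφ : ‖φ‖ = 1) {Ω : Set (ℝ × ℝ)}
    (hΩ : volume Ω < ⊤) {ψ : ℕ → L2R} {lam : ℕ → ℝ}
    (h : IsEigensystem (concentrationOp φ Ω) ψ lam) :
    ∑' k, ENNReal.ofReal (|lam k| ^ 2)
      = ∫⁻ z in Ω, ∫⁻ w in Ω, ‖gaborTransform φ φ (w - z)‖ₑ ^ 2 := by
  have : IsFiniteMeasure (volume.restrict Ω) := isFiniteMeasure_restrict.mpr hΩ.ne
  rw [(isFrameOperator_concentrationOp hφ hΩ).tsum_ofReal_sq_eigenvalues h.orthonormal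
    h.apply_eq h.complete]
  simp_rw [enorm_inner_shift]

/-- Measurability of `Ω` is meant in the sense of Lebesgue, hence `NullMeasurableSet`. The
eigensystems in the second part are arbitrary and chosen independently for each `r`. -/
theorem mainTheorem5 (φ : L2R) (hφ : ‖φ‖ = 1) (Ω : Set (ℝ × ℝ))
    (hΩ_meas : NullMeasurableSet Ω volume) (hΩ_bdd : Bornology.IsBounded Ω)
    (hΩ_pos : 0 < volume Ω) :
    (∀ r : ℝ, 0 < r → ∃ (ψ : ℕ → L2R) (lam : ℕ → ℝ),
        IsEigensystem (concentrationOp φ (dilatedRegion r Ω)) ψ lam) ∧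
    ∀ (ψ : ℝ → ℕ → L2R) (lam : ℝ → ℕ → ℝ),
      (∀ r : ℝ, 0 < r →
        IsEigensystem (concentrationOp φ (dilatedRegion r Ω)) (ψ r) (lam r)) →
      (∀ r : ℝ, 0 < r → Summable fun k => |lam r k| ^ 2) ∧
      Tendsto (fun r : ℝ => (∑' k, |lam r k| ^ 2) / volume.real (dilatedRegion r Ω))
        atTop (𝓝 1) := by
  simp only [dilatedRegion_eq_smul]
  have hfin : volume Ω < ⊤ := hΩ_bdd.measure_lt_top
  have hfinr : ∀ (B : Set (ℝ × ℝ)) (r : ℝ), volume B < ⊤ → volume (r • B) < ⊤ := by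
    intro B r hB
    rw [volume_smul_plane]
    exact ENNReal.mul_lt_top ENNReal.ofReal_lt_top hB
  refine ⟨fun r _ => ?_, fun ψ lam hsys => ?_⟩
  · have : IsFiniteMeasure (volume.restrict (r • Ω)) :=
      isFiniteMeasure_restrict.mpr (hfinr Ω r hfin).ne
    obtain ⟨ψ, lam, h1, h2, h3, h4, h5⟩ :=
      (isFrameOperator_concentrationOp hφ (hfinr Ω r hfin)).exists_eigensequence
        not_finiteDimensional_L2R
    exact ⟨ψ, lam, h1, h2, h3, h4, h5⟩
  -- The Tonelli arguments need a Borel set; a null set changes neither the operator nor the area.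
  obtain ⟨A, -, hA, hAΩ⟩ := hΩ_meas.exists_measurable_subset_ae_eq
  have hvol : volume A = volume Ω := measure_congr hAΩ
  have hAfin : volume A < ⊤ := hvol ▸ hfin
  have hsmul : ∀ r : ℝ, 0 < r → (r • A : Set (ℝ × ℝ)) =ᵐ[volume] (r • Ω : Set (ℝ × ℝ)) :=
    fun r hr => smul_ae_eq_smul r hr.ne' hAΩ
  let F : ℝ × ℝ → ENNReal := fun u => ‖gaborTransform φ φ u‖ₑ ^ 2
  have hF : Measurable F :=
    (stronglyMeasurable_gaborTransform φ φ).measurable.enorm.pow_const 2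
  have hF1 : ∫⁻ u, F u = 1 := by
    rw [lintegral_enorm_gaborTransform_sq, ← ofReal_norm, hφ]; simp
  have hsum : ∀ r : ℝ, 0 < r → ∑' k, ENNReal.ofReal (|lam r k| ^ 2)
      = ∫⁻ z in r • A, ∫⁻ w in r • A, F (w - z) := by
    intro r hr
    have h := hsys r hr
    rw [← concentrationOp_congr φ (hsmul r hr)] at h
    exact h.tsum_ofReal_sq hφ (hfinr A r hAfin)
  -- The overlap is at most the area of `r • A` and `∫ F = 1`, so the sum of squares is at most that
  -- area; finiteness here gives the summability claim.
  have htop : ∀ r : ℝ, 0 < r → ∑' k, ENNReal.ofReal (|lam r k| ^ 2) ≠ ⊤ := by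
    intro r hr
    rw [hsum r hr, setLIntegral_setLIntegral_sub hF (hA.const_smul₀ r)]
    refine ne_top_of_le_ne_top (hfinr A r hAfin).ne (b := volume (r • A)) ?_
    calc ∫⁻ u, volume ((r • A) ∩ (u + ·) ⁻¹' (r • A)) * F u
        ≤ ∫⁻ u, volume (r • A) * F u := by
          refine lintegral_mono fun u => ?_
          gcongr
          exact Set.inter_subset_left
      _ = volume (r • A) := by rw [lintegral_const_mul _ hF, hF1, mul_one]
  have htoReal : ∀ r k, (ENNReal.ofReal (|lam r k| ^ 2)).toReal = |lam r k| ^ 2 :=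
    fun r k => ENNReal.toReal_ofReal (by positivity)
  refine ⟨fun r hr => ?_, ?_⟩
  · simpa only [htoReal] using ENNReal.summable_toReal (htop r hr)
  have hlim := tendsto_setLIntegral_sub_div_volume hF (by simp [hF1]) hA
    (hvol ▸ hΩ_pos.ne') hAfin.ne
  rw [hF1] at hlim
  have hreal := (ENNReal.tendsto_toReal ENNReal.one_ne_top).comp hlim
  rw [ENNReal.toReal_one] at hreal
  refine hreal.congr' ?_
  filter_upwards [eventually_gt_atTop 0] with r hr
  rw [Function.comp_apply, ← hsum r hr, ENNReal.toReal_div,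
    ENNReal.tsum_toReal_eq fun _ => ENNReal.ofReal_ne_top, measure_congr (hsmul r hr)]
  simp_rw [htoReal]
  rfl
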